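/- Let $n_1,n_2\ge 0$, $n=n_1+n_2$, $K\ge 1$ and $\mathcal K=\{1,\dots,K\}$. Let $$X=\{(\mathbf x^{(1)},\mathbf x^{(2)})\in\mathbb R_+^{n_1}\times\mathbb Z_+^{n_2}:\ \mathbf G_1\mathbf x^{(1)}+\mathbf G_2\mathbf x^{(2)}\le\mathbf g\}$$ be a linear mixed-integer set, let $\ell(\mathbf x,\mathbf c)=\mathbf c^\top\mathbf T\mathbf x+\mathbf t_1^\top\mathbf x+\mathbf t_2^\top\mathbf c+t_0$ with $\mathbf T=\mathbf T^\top\in\mathbb R^{n\times n}$, $\mathbf t_1,\mathbf t_2\in\mathbb R^n$, $t_0\in\mathbb R$, let $\mathcal S_0=\{\mathbf c\in\mathbb R^n:\mathbf B^{(0)}\mathbf c\le\mathbf b^{(0)}\}$ be bounded, and let $\mathcal S_k=\{\mathbf c\in\mathbb R^n:\mathbf B^{(k)}\mathbf c\le\mathbf b^{(k)}\}$, $k\in\mathcal K$, be nonempty polyhedra contained in $\mathcal S_0$. Let $\varepsilon_K>0$. For $\widehat{\mathbf C}=(\hat{\mathbf c}^{(1)},\dots,\hat{\mathbf c}^{(K)})$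 let $\widehat{\mathbb Q}_K(\widehat{\mathbf C})=\frac1K\sum_{k=1}^K\delta_{\hat{\mathbf c}^{(k)}}$, and let $\mathcal Q(\widehat{\mathbf C})$ be the set of all probability distributions $\mathbb Q$ on $\mathcal S_0$ with $W^1(\widehat{\mathbb Q}_K(\widehat{\mathbf C}),\mathbb Q)\le\varepsilon_K$, where $W^1(\mathbb Q,\mathbb Q')=\inf_\pi\int\|\mathbf c-\mathbf c'\|_1\,\pi(\mathrm d\mathbf c,\mathrm d\mathbf c')$ over all joint distributions $\pi$ with marginals $\mathbb Q$ and $\mathbb Q'$. Consider the three-level problem $$(\mathbf F)\qquad \min_{\mathbf x\in X}\ F(\mathbf x),\qquad F(\mathbf x)=\max_{\widehat{\mathbf C}:\ \hat{\mathbf c}^{(k)}\in\mathcal S_k\ \forall k\in\mathcal K}\ \ \max_{\mathbb Q\in\mathcal Q(\widehat{\mathbf C})}\ \mathbb E_{\mathbb Q}\{\ell(\mathbf x,\mathbf c)\},$$ and the problem $$\begin{aligned}(\mathbf F^{(mip)})\qquad \min_{\mathbf x,\lambda,\boldsymbol\nu,\boldsymbol\gamma}\ &\ \lambda\varepsilon_K+\frac1K\sum_{k=1}^K\mathbf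 b^{(0)\top}\boldsymbol\nu^{(k)}+\sum_{k=1}^K\mathbf b^{(k)\top}\boldsymbol\gamma^{(k)}+\mathbf t_1^\top\mathbf x+t_0\\ \text{s.t. }&\ \tfrac1K(\mathbf T\mathbf x+\mathbf t_2-\mathbf B^{(0)\top}\boldsymbol\nu^{(k)})=\mathbf B^{(k)\top}\boldsymbol\gamma^{(k)}\quad\forall k\in\mathcal K,\\ &\ -\lambda\mathbf 1\le\mathbf T\mathbf x+\mathbf t_2-\mathbf B^{(0)\top}\boldsymbol\nu^{(k)}\le\lambda\mathbf 1\quad\forall k\in\mathcal K,\\ &\ \boldsymbol\nu^{(k)},\boldsymbol\gamma^{(k)}\ge\mathbf 0\quad\forall k\in\mathcal K,\qquad \lambda\ge0,\qquad \mathbf x\in X.\end{aligned}$$ Then $(\mathbf F^{(mip)})$ is a mixed-integer linear program whose integer variables are the components of $\mathbf x^{(2)}$, and it is a reformulation of $(\mathbf F)$: for every $\mathbf x\in X$ both maxima in $F(\mathbf x)$ are attained, and $F(\mathbf x)$ equals the (attained) minimum of the objective of $(\mathbf F^{(mip)})$ over all $(\lambda,\boldsymbol\nu,\boldsymbol\gamma)$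 such that $(\mathbf x,\lambda,\boldsymbol\nu,\boldsymbol\gamma)$ is feasible. Consequently, the optimal values (infima in $[-\infty,+\infty]$) of both problems coincide, and $\mathbf x$ is an optimal solution of $(\mathbf F)$ if and only if $(\mathbf x,\lambda,\boldsymbol\nu,\boldsymbol\gamma)$ is an optimal solution of $(\mathbf F^{(mip)})$ for some $\lambda,\boldsymbol\nu,\boldsymbol\gamma$. -/

import Mathlib

open MeasureTheory
open scoped Matrix ENNReal

noncomputable section

namespace DRO

/-- The index set of the components of a decision `x = (x⁽¹⁾, x⁽²⁾)` (`n₁` continuous and `n₂`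
integer ones) and of a cost vector `c`; it has `n = n₁ + n₂` elements. -/
abbrev Ix (n₁ n₂ : ℕ) : Type := Fin n₁ ⊕ Fin n₂

/-- The polyhedron `{c | B c ≤ b}`. -/
def polyhedron {n w : Type} [Fintype n] (B : Matrix w n ℝ) (b : w → ℝ) : Set (n → ℝ) :=
  {c | B *ᵥ c ≤ b}

/-- The `l₁`-norm. -/
def l1norm {n : Type} [Fintype n] (c : n → ℝ) : ℝ := ∑ a, |c a|

/-- The Borel probability distributions supported on `S`. -/
def distributionsOn {n : Type} (S : Set (n → ℝ)) : Set (Measure (n → ℝ)) :=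
  {Q | IsProbabilityMeasure Q ∧ Q Sᶜ = 0}

/-- The joint distributions with marginals `Q` and `Q'`. If `Q` and `Q'` are supported on `S`,
then every one of them is supported on `S × S`. -/
def couplings {n : Type} (Q Q' : Measure (n → ℝ)) : Set (Measure ((n → ℝ) × (n → ℝ))) :=
  {π | IsProbabilityMeasure π ∧ π.map Prod.fst = Q ∧ π.map Prod.snd = Q'}

/-- The type-1 Wasserstein distance with respect to the `l₁`-norm. -/
def wasserstein {n : Type} [Fintype n] (Q Q' : Measure (n → ℝ)) : ℝ≥0∞ :=
  ⨅ π ∈ couplings Q Q', ∫⁻ p, ENNReal.ofReal (l1norm (p.1 - p.2)) ∂π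

/-- The empirical distribution `(1/K) ∑ₖ δ_{ĉ⁽ᵏ⁾}` of a data set. -/
def empirical {n : Type} {K : ℕ} (C : Fin K → n → ℝ) : Measure (n → ℝ) :=
  (K : ℝ≥0∞)⁻¹ • ∑ k, Measure.dirac (C k)

/-- The ambiguity set: all distributions on `S₀` at Wasserstein distance at most `ε` from the
empirical distribution of the data set `C`. -/
def ambiguitySet {n : Type} [Fintype n] {K : ℕ} (S₀ : Set (n → ℝ)) (ε : ℝ)
    (C : Fin K → n → ℝ) : Set (Measure (n → ℝ)) :=
  {Q | Q ∈ distributionsOn S₀ ∧ wasserstein (empirical C) Q ≤ ENNReal.ofReal ε}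

/-- The numerical data of the three-level problem. -/
structure Data (n₁ n₂ m K w₀ : ℕ) (w : Fin K → ℕ) where
  /-- constraints of the set of feasible decisions -/
  G₁ : Matrix (Fin m) (Fin n₁) ℝ
  G₂ : Matrix (Fin m) (Fin n₂) ℝ
  g : Fin m → ℝ
  /-- coefficients of the loss function -/
  T : Matrix (Ix n₁ n₂) (Ix n₁ n₂) ℝ
  t₁ : Ix n₁ n₂ → ℝ
  t₂ : Ix n₁ n₂ → ℝ
  t₀ : ℝ
  /-- constraints of the support set -/
  B₀ : Matrix (Fin w₀) (Ix n₁ n₂) ℝ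
  b₀ : Fin w₀ → ℝ
  /-- constraints of the data uncertainty sets -/
  B : (k : Fin K) → Matrix (Fin (w k)) (Ix n₁ n₂) ℝ
  b : (k : Fin K) → Fin (w k) → ℝ
  /-- Wasserstein radius -/
  ε : ℝ

namespace Data

variable {n₁ n₂ m K w₀ : ℕ} {w : Fin K → ℕ} (D : Data n₁ n₂ m K w₀ w)

/-- The linear mixed-integer set
`X = {(x⁽¹⁾, x⁽²⁾) ∈ ℝ₊^{n₁} × ℤ₊^{n₂} | G₁ x⁽¹⁾ + G₂ x⁽²⁾ ≤ g}`. -/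
def X : Set (Ix n₁ n₂ → ℝ) :=
  {x | (∀ a, 0 ≤ x a) ∧ (∀ j : Fin n₂, ∃ z : ℤ, x (Sum.inr j) = z) ∧
    D.G₁ *ᵥ (fun i => x (Sum.inl i)) + D.G₂ *ᵥ (fun j => x (Sum.inr j)) ≤ D.g}

/-- The biaffine loss `ℓ(x, c) = cᵀTx + t₁ᵀx + t₂ᵀc + t₀`. -/
def loss (x c : Ix n₁ n₂ → ℝ) : ℝ :=
  c ⬝ᵥ (D.T *ᵥ x) + D.t₁ ⬝ᵥ x + D.t₂ ⬝ᵥ c + D.t₀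

/-- The support set `S₀`. -/
def S₀ : Set (Ix n₁ n₂ → ℝ) := polyhedron D.B₀ D.b₀

/-- The data uncertainty sets `Sₖ`. -/
def S (k : Fin K) : Set (Ix n₁ n₂ → ℝ) := polyhedron (D.B k) (D.b k)

/-- The admissible data sets: `ĉ⁽ᵏ⁾ ∈ Sₖ` for all `k`. -/
def dataSets : Set (Fin K → Ix n₁ n₂ → ℝ) := {C | ∀ k, C k ∈ D.S k}

/-- The expected loss of `x` under `Q`. -/
def expectedLoss (x : Ix n₁ n₂ → ℝ) (Q : Measure (Ix n₁ n₂ → ℝ)) : ℝ := ∫ c, D.loss x c ∂Q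

/-- Third level: the worst-case expected loss over the ambiguity set around the data set `C`. -/
def worstCase (x : Ix n₁ n₂ → ℝ) (C : Fin K → Ix n₁ n₂ → ℝ) : EReal :=
  ⨆ Q ∈ ambiguitySet D.S₀ D.ε C, (D.expectedLoss x Q : EReal)

/-- Second level: the worst case over the admissible data sets, that is, the objective function
of the three-level problem (F) at `x`. -/
def robustLoss (x : Ix n₁ n₂ → ℝ) : EReal := ⨆ C ∈ D.dataSets, D.worstCase x C

/-- First level: the optimal value of (F). -/
def valueF : EReal := ⨅ x ∈ D.X, D.robustLoss x

/-- `x` is an optimal solution of (F). -/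
def IsOptimalF (x : Ix n₁ n₂ → ℝ) : Prop :=
  x ∈ D.X ∧ ∀ x' ∈ D.X, D.robustLoss x ≤ D.robustLoss x'

/-- The constraints of the single-level reformulation (F^mip). -/
def MipFeasible (x : Ix n₁ n₂ → ℝ) (lam : ℝ) (ν : Fin K → Fin w₀ → ℝ)
    (γ : (k : Fin K) → Fin (w k) → ℝ) : Prop :=
  (∀ k, (1 / (K : ℝ)) • (D.T *ᵥ x + D.t₂ - D.B₀ᵀ *ᵥ ν k) = (D.B k)ᵀ *ᵥ γ k) ∧
  (∀ k a, -lam ≤ (D.T *ᵥ x + D.t₂ - D.B₀ᵀ *ᵥ ν k) a ∧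
    (D.T *ᵥ x + D.t₂ - D.B₀ᵀ *ᵥ ν k) a ≤ lam) ∧
  (∀ k, (∀ i, 0 ≤ ν k i) ∧ ∀ i, 0 ≤ γ k i) ∧
  0 ≤ lam ∧
  x ∈ D.X

/-- The objective function of (F^mip). -/
def mipObj (x : Ix n₁ n₂ → ℝ) (lam : ℝ) (ν : Fin K → Fin w₀ → ℝ)
    (γ : (k : Fin K) → Fin (w k) → ℝ) : ℝ :=
  lam * D.ε + (1 / (K : ℝ)) * ∑ k, D.b₀ ⬝ᵥ ν k + ∑ k, D.b k ⬝ᵥ γ k + D.t₁ ⬝ᵥ x + D.t₀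

/-- The optimal value of (F^mip). -/
def valueMip : EReal :=
  ⨅ (x : Ix n₁ n₂ → ℝ) (lam : ℝ) (ν : Fin K → Fin w₀ → ℝ) (γ : (k : Fin K) → Fin (w k) → ℝ)
    (_ : D.MipFeasible x lam ν γ), (D.mipObj x lam ν γ : EReal)

/-- `(x, λ, ν, γ)` is an optimal solution of (F^mip). -/
def IsOptimalMip (x : Ix n₁ n₂ → ℝ) (lam : ℝ) (ν : Fin K → Fin w₀ → ℝ)
    (γ : (k : Fin K) → Fin (w k) → ℝ) : Prop :=
  D.MipFeasible x lam ν γ ∧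
    ∀ x' lam' ν' γ', D.MipFeasible x' lam' ν' γ' → D.mipObj x lam ν γ ≤ D.mipObj x' lam' ν' γ'

end Data

/-- A mixed-integer linear program in the variables `y : V → ℝ` with `r` constraints:
minimize `dᵀy + d₀` subject to `A y ≤ b` and `y v ∈ ℤ` for all `v` in `int`. -/
structure MILP (r : ℕ) (V : Type) where
  A : Matrix (Fin r) V ℝ
  b : Fin r → ℝ
  d : V → ℝ
  d₀ : ℝ
  int : Set V

/-- The feasible points of a mixed-integer linear program. -/
def MILP.Feasible {r : ℕ} {V : Type} [Fintype V] (P : MILP r V) (y : V → ℝ) : Prop :=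
  P.A *ᵥ y ≤ P.b ∧ ∀ v ∈ P.int, ∃ z : ℤ, y v = z

/-- The objective function of a mixed-integer linear program. -/
def MILP.obj {r : ℕ} {V : Type} [Fintype V] (P : MILP r V) (y : V → ℝ) : ℝ :=
  P.d ⬝ᵥ y + P.d₀

/-- The index set of the scalar variables of (F^mip): the components of `x`, then `λ`, then the
components of all `ν⁽ᵏ⁾`, then those of all `γ⁽ᵏ⁾`. -/
abbrev Var (n₁ n₂ K w₀ : ℕ) (w : Fin K → ℕ) : Type :=
  Ix n₁ n₂ ⊕ Unit ⊕ (Fin K × Fin w₀) ⊕ ((k : Fin K) × Fin (w k))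

/-- The variables `(x, λ, ν, γ)` listed as one vector. -/
def varVector {n₁ n₂ K w₀ : ℕ} {w : Fin K → ℕ} (x : Ix n₁ n₂ → ℝ) (lam : ℝ)
    (ν : Fin K → Fin w₀ → ℝ) (γ : (k : Fin K) → Fin (w k) → ℝ) : Var n₁ n₂ K w₀ w → ℝ :=
  Sum.elim x (Sum.elim (fun _ => lam) (Sum.elim (fun p => ν p.1 p.2) (fun p => γ p.1 p.2)))

end DRO

end

/-! For fixed `x` the loss is affine in `c` with slope `v = T x + t₂`, so only the linear functional
`v ⬝ᵥ c` matters. The theorem is then linear programming duality, and the infinite-dimensional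
maximization over distributions is handled without any infinite-dimensional duality.

Weak duality (`integral_le_dual`): write γ for K times the multipliers of (F^mip), so that `v = B₀ᵀ
ν k + (B k)ᵀ γ k` and the entries of `(B k)ᵀ γ k` are at most λ in absolute value. Then every point
`c` of the support and every `C k` in its uncertainty set satisfy `v ⬝ᵥ c ≤ b₀ ⬝ᵥ ν k + b k ⬝ᵥ γ k +
lam * l1norm (C k - c)`. Integrating this against a nearly optimal coupling bounds the expectation
for every admissible data set and every distribution in its ambiguity set.

Strong duality (`exists_optimal_primal_dual`): allow only distributions with K equal atoms `d k`,
where `C k` is moved to `d k` within total `l₁`-budget `K * ε`. This is a finite linear program over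
a compact set. Its maximum is attained, and Farkas' lemma gives multipliers whose dual value does
not exceed it (`transport_lp_duality`). By weak duality the same multipliers bound all
distributions, so the K-atom optimum is a global one. -/

noncomputable section

namespace DRO

/-! ### Farkas' lemma and duality for the finite transport program -/

/-- **Farkas' lemma** for linear functionals on an arbitrary real vector space. -/
theorem farkas {E ι : Type*} [AddCommGroup E] [Module ℝ E] (s : Finset ι) :
    ∀ (f : ι → E →ₗ[ℝ] ℝ) (g : E →ₗ[ℝ] ℝ), (∀ y, (∀ i ∈ s, f i y ≤ 0) → g y ≤ 0) →
      ∃ μ : ι → ℝ, (∀ i, 0 ≤ μ i) ∧ ∀ y, g y = ∑ i ∈ s, μ i * f i y := by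
  classical
  induction s using Finset.induction_on with
  | empty =>
    intro f g h
    refine ⟨0, fun _ => le_rfl, fun y => ?_⟩
    have h1 := h y (by simp)
    have h2 := h (-y) (by simp)
    rw [map_neg] at h2
    simp only [Finset.sum_empty]
    linarith
  | insert j s hj ih =>
    intro f g h
    by_cases hs : ∀ y, (∀ i ∈ s, f i y ≤ 0) → g y ≤ 0
    · obtain ⟨μ, hμ, hg⟩ := ih f g hs
      refine ⟨fun i => if i = j then 0 else μ i, fun i => ?_, fun y => ?_⟩
      · dsimp only
        split_ifs
        exacts [le_rfl, hμ i]
      · rw [Finset.sum_insert hj, hg y]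
        simp only [if_true, zero_mul, zero_add]
        refine Finset.sum_congr rfl fun i hi => ?_
        rw [if_neg (ne_of_mem_of_not_mem hi hj)]
    · push Not at hs
      obtain ⟨z, hz, hgz⟩ := hs
      have hjz : 0 < f j z := by
        by_contra hcon
        refine absurd (h z fun i hi => ?_) (not_le.2 hgz)
        rcases Finset.mem_insert.1 hi with rfl | hi
        exacts [not_lt.1 hcon, hz i hi]
      -- These are the functionals composed with the projection `y ↦ y - (f j y / f j z) • z` onto
      -- the kernel of `f j`. Constraint `j` holds with equality there, so the induction hypothesis
      -- applies without it.
      obtain ⟨μ, hμ, hg⟩ := ih (fun i => f i - (f i z / f j z) • f j)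
        (g - (g z / f j z) • f j) (by
          intro y hy
          have := h (y - (f j y / f j z) • z) (fun i hi => by
            rcases Finset.mem_insert.1 hi with rfl | hi
            · simp [hjz.ne']
            · have := hy i hi
              simp only [LinearMap.sub_apply, LinearMap.smul_apply, smul_eq_mul, map_sub,
                map_smul] at this ⊢
              calc _ = _ := by ring
                _ ≤ 0 := this)
          simp only [LinearMap.sub_apply, LinearMap.smul_apply, smul_eq_mul, map_sub,
            map_smul] at this ⊢
          calc _ = _ := by ring
            _ ≤ 0 := this)
      have hsum : ∑ i ∈ s, μ i * f i z ≤ 0 :=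
        Finset.sum_nonpos fun i hi => mul_nonpos_of_nonneg_of_nonpos (hμ i) (hz i hi)
      -- Undoing the projection gives the coefficient of `f j`; it is nonnegative because `g z > 0`
      -- and the sum at `z` is nonpositive.
      refine ⟨fun i => if i = j then (g z - ∑ i ∈ s, μ i * f i z) / f j z else μ i,
        fun i => ?_, fun y => ?_⟩
      · dsimp only
        split_ifs
        · exact div_nonneg (by linarith) hjz.le
        · exact hμ i
      · rw [Finset.sum_insert hj]
        have h1 : ∑ i ∈ s, (if i = j then (g z - ∑ i ∈ s, μ i * f i z) / f j z else μ i) * f i y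
            = ∑ i ∈ s, μ i * f i y := Finset.sum_congr rfl fun i hi => by
          rw [if_neg (ne_of_mem_of_not_mem hi hj)]
        have h2 := hg y
        simp only [LinearMap.sub_apply, LinearMap.smul_apply, smul_eq_mul, mul_sub,
          Finset.sum_sub_distrib] at h2
        have h3 : ∑ i ∈ s, μ i * (f i z / f j z * f j y)
            = (∑ i ∈ s, μ i * f i z) / f j z * f j y := by
          rw [Finset.sum_div, Finset.sum_mul]
          exact Finset.sum_congr rfl fun i _ => by ring
        simp only [if_true, h1]
        rw [h3] at h2
        rw [sub_div, sub_mul]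
        linarith

/-- The affine form of Farkas' lemma: a valid inequality of a feasible finite system is dominated
by a nonnegative combination of its constraints. -/
theorem affine_farkas {E ι : Type*} [AddCommGroup E] [Module ℝ E] [Fintype ι]
    (f : ι → E →ₗ[ℝ] ℝ) (b : ι → ℝ) (g : E →ₗ[ℝ] ℝ) (M : ℝ) (hne : ∃ y, ∀ i, f i y ≤ b i)
    (h : ∀ y, (∀ i, f i y ≤ b i) → g y ≤ M) :
    ∃ μ : ι → ℝ, (∀ i, 0 ≤ μ i) ∧ (∀ y, g y = ∑ i, μ i * f i y) ∧ ∑ i, μ i * b i ≤ M := by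
  obtain ⟨y₀, hy₀⟩ := hne
  -- Homogenization: a coordinate `t ≥ 0` turns the affine system into `f i y ≤ b i * t`, with claim
  -- `g y ≤ M * t`.
  let F : Option ι → (E × ℝ) →ₗ[ℝ] ℝ := fun o => o.elim (-LinearMap.snd ℝ E ℝ)
    fun i => f i ∘ₗ LinearMap.fst ℝ E ℝ - b i • LinearMap.snd ℝ E ℝ
  let G : (E × ℝ) →ₗ[ℝ] ℝ := g ∘ₗ LinearMap.fst ℝ E ℝ - M • LinearMap.snd ℝ E ℝ
  have hF (i : ι) (p : E × ℝ) : F (some i) p = f i p.1 - b i * p.2 := rfl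
  have hF0 (p : E × ℝ) : F none p = -p.2 := rfl
  have hG (p : E × ℝ) : G p = g p.1 - M * p.2 := rfl
  obtain ⟨μ, hμ, hsum⟩ := farkas Finset.univ F G (by
    rintro ⟨y, t⟩ hy
    have ht : 0 ≤ t := by simpa [hF0] using hy none (Finset.mem_univ _)
    have hyi (i : ι) : f i y ≤ b i * t := by
      simpa [hF] using hy (some i) (Finset.mem_univ _)
    rw [hG]
    dsimp only
    rcases ht.eq_or_lt with rfl | ht
    · by_contra hcon
      have hpos : 0 < g y := by linarith
      -- For `t = 0`, `y` is a recession direction. This step length raises `g` to `M + g y`, which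
      -- exceeds `M` if `g y > 0`.
      have := h (y₀ + ((M - g y₀) / g y + 1) • y) (fun i => by
        have h1 := hyi i
        have h2 : 0 ≤ (M - g y₀) / g y :=
          div_nonneg (sub_nonneg.2 (h y₀ hy₀)) hpos.le
        have h3 := hy₀ i
        rw [map_add, map_smul, smul_eq_mul]
        nlinarith)
      rw [map_add, map_smul, smul_eq_mul, add_mul, div_mul_cancel₀ _ hpos.ne'] at this
      linarith
    · have := h (t⁻¹ • y) (fun i => by
        rw [map_smul, smul_eq_mul, inv_mul_le_iff₀ ht, mul_comm]
        exact hyi i)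
      rw [map_smul, smul_eq_mul, inv_mul_le_iff₀ ht] at this
      linarith)
  -- At `(y, 0)` the homogeneous identity represents `g`; at `(0, 1)` it says that the combined
  -- right-hand side is `M - μ none`.
  refine ⟨fun i => μ (some i), fun i => hμ _, fun y => ?_, ?_⟩
  · have := hsum (y, 0)
    simpa [Fintype.sum_option, hF, hF0, hG] using this
  · have := hsum (0, 1)
    simp only [Fintype.sum_option, hF, hF0, hG, map_zero, mul_one, zero_sub, mul_neg,
      Finset.sum_neg_distrib] at this
    have := hμ none
    linarith

/-- The variables of the linear program of transporting `K` points to `K` points in `ℝⁿ`: the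
origins, the destinations, and bounds of the absolute values of their differences. -/
abbrev TransportVars (n : Type) (K : ℕ) : Type :=
  (Fin K → n → ℝ) × (Fin K → n → ℝ) × (Fin K → n → ℝ)

/-- Linear programming duality for the problem of choosing `c k ∈ {c | B k c ≤ b k}` and
`d k ∈ {d | B₀ d ≤ b₀}` within a total `l₁`-budget `R`. -/
theorem transport_lp_duality {n w₀ : Type} [Fintype n] [Fintype w₀] {K : ℕ} {w : Fin K → Type}
    [∀ k, Fintype (w k)] (B₀ : Matrix w₀ n ℝ) (b₀ : w₀ → ℝ) (B : ∀ k, Matrix (w k) n ℝ)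
    (b : ∀ k, w k → ℝ) (R : ℝ) (v : n → ℝ) (M : ℝ)
    (hne : ∃ c d : Fin K → n → ℝ, (∀ k, c k ∈ polyhedron (B k) (b k)) ∧
      (∀ k, d k ∈ polyhedron B₀ b₀) ∧ ∑ k, l1norm (c k - d k) ≤ R)
    (hM : ∀ c d : Fin K → n → ℝ, (∀ k, c k ∈ polyhedron (B k) (b k)) →
      (∀ k, d k ∈ polyhedron B₀ b₀) → ∑ k, l1norm (c k - d k) ≤ R → ∑ k, v ⬝ᵥ d k ≤ M) :
    ∃ (lam : ℝ) (ν : Fin K → w₀ → ℝ) (γ : ∀ k, w k → ℝ), 0 ≤ lam ∧ (∀ k i, 0 ≤ ν k i) ∧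
      (∀ k i, 0 ≤ γ k i) ∧ (∀ k, v - B₀ᵀ *ᵥ ν k = (B k)ᵀ *ᵥ γ k) ∧
      (∀ k a, |((B k)ᵀ *ᵥ γ k) a| ≤ lam) ∧
      lam * R + ∑ k, b₀ ⬝ᵥ ν k + ∑ k, b k ⬝ᵥ γ k ≤ M := by
  classical
  -- Constraint families: origins in their polyhedra, destinations in the support, `d - c ≤ s`, `c -
  -- d ≤ s`, and the budget on the sum of `s`. The last three linearize the `l₁`-cost.
  let ι := ((k : Fin K) × w k) ⊕ (Fin K × w₀) ⊕ (Fin K × n) ⊕ (Fin K × n) ⊕ Unit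
  let f₁ : ((k : Fin K) × w k) → TransportVars n K →ₗ[ℝ] ℝ := fun i =>
    { toFun := fun y => (B i.1 *ᵥ y.1 i.1) i.2
      map_add' := fun y z => by simp [Matrix.mulVec_add]
      map_smul' := fun r y => congrFun (Matrix.mulVec_smul (B i.1) r (y.1 i.1)) i.2 }
  let f₂ : (Fin K × w₀) → TransportVars n K →ₗ[ℝ] ℝ := fun i =>
    { toFun := fun y => (B₀ *ᵥ y.2.1 i.1) i.2
      map_add' := fun y z => by simp [Matrix.mulVec_add]
      map_smul' := fun r y => congrFun (Matrix.mulVec_smul B₀ r (y.2.1 i.1)) i.2 }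
  let f₃ : (Fin K × n) → TransportVars n K →ₗ[ℝ] ℝ := fun i =>
    { toFun := fun y => y.2.1 i.1 i.2 - y.1 i.1 i.2 - y.2.2 i.1 i.2
      map_add' := fun y z => by simp; ring
      map_smul' := fun r y => by simp; ring }
  let f₄ : (Fin K × n) → TransportVars n K →ₗ[ℝ] ℝ := fun i =>
    { toFun := fun y => y.1 i.1 i.2 - y.2.1 i.1 i.2 - y.2.2 i.1 i.2
      map_add' := fun y z => by simp; ring
      map_smul' := fun r y => by simp; ring }
  let f₅ : TransportVars n K →ₗ[ℝ] ℝ :=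
    { toFun := fun y => ∑ k, ∑ a, y.2.2 k a
      map_add' := fun y z => by simp [Finset.sum_add_distrib]
      map_smul' := fun r y => by simp [Finset.mul_sum] }
  let g : TransportVars n K →ₗ[ℝ] ℝ :=
    { toFun := fun y => ∑ k, v ⬝ᵥ y.2.1 k
      map_add' := fun y z => by simp [Finset.sum_add_distrib]
      map_smul' := fun r y => by simp [Finset.mul_sum] }
  let f : ι → TransportVars n K →ₗ[ℝ] ℝ :=
    Sum.elim f₁ (Sum.elim f₂ (Sum.elim f₃ (Sum.elim f₄ fun _ => f₅)))
  let β : ι → ℝ :=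
    Sum.elim (fun i => b i.1 i.2) (Sum.elim (fun i => b₀ i.2)
      (Sum.elim (fun _ => 0) (Sum.elim (fun _ => 0) fun _ => R)))
  obtain ⟨μ, hμ, hg, hb⟩ := affine_farkas f β g M (by
    obtain ⟨c, d, hc, hd, hR⟩ := hne
    refine ⟨(c, d, fun k a => |c k a - d k a|), ?_⟩
    rintro (⟨k, i⟩ | ⟨k, i⟩ | ⟨k, a⟩ | ⟨k, a⟩ | _)
    · exact hc k i
    · exact hd k i
    · change d k a - c k a - |c k a - d k a| ≤ 0
      have := neg_abs_le (c k a - d k a)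
      linarith
    · change c k a - d k a - |c k a - d k a| ≤ 0
      have := le_abs_self (c k a - d k a)
      linarith
    · exact hR) (by
    rintro ⟨c, d, s⟩ hy
    refine hM c d (fun k i => hy (Sum.inl ⟨k, i⟩)) (fun k i => hy (Sum.inr (Sum.inl ⟨k, i⟩))) ?_
    refine le_trans (Finset.sum_le_sum fun k _ => Finset.sum_le_sum fun a _ => ?_)
      (hy (Sum.inr (Sum.inr (Sum.inr (Sum.inr ())))))
    have h3 : d k a - c k a - s k a ≤ 0 := hy (Sum.inr (Sum.inr (Sum.inl ⟨k, a⟩)))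
    have h4 : c k a - d k a - s k a ≤ 0 := hy (Sum.inr (Sum.inr (Sum.inr (Sum.inl ⟨k, a⟩))))
    rw [Pi.sub_apply, abs_le]
    constructor <;> linarith)
  set lam := μ (Sum.inr (Sum.inr (Sum.inr (Sum.inr ()))))
  set γ : ∀ k, w k → ℝ := fun k i => μ (Sum.inl ⟨k, i⟩) with hγ
  set ν : Fin K → w₀ → ℝ := fun k i => μ (Sum.inr (Sum.inl ⟨k, i⟩)) with hν
  set p : Fin K → n → ℝ := fun k a => μ (Sum.inr (Sum.inr (Sum.inl ⟨k, a⟩)))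
  set q : Fin K → n → ℝ := fun k a => μ (Sum.inr (Sum.inr (Sum.inr (Sum.inl ⟨k, a⟩))))
  have key (c d s : Fin K → n → ℝ) : ∑ k, v ⬝ᵥ d k =
      ∑ k, ∑ i, γ k i * (B k *ᵥ c k) i + (∑ k, ∑ i, ν k i * (B₀ *ᵥ d k) i +
      (∑ k, ∑ a, p k a * (d k a - c k a - s k a) + (∑ k, ∑ a, q k a * (c k a - d k a - s k a) +
        lam * ∑ k, ∑ a, s k a))) := by
    have := hg (c, d, s)
    simp only [ι, Fintype.sum_sum_type, Fintype.sum_sigma, Fintype.sum_prod_type,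
      Finset.univ_unique, Finset.sum_singleton] at this
    exact this
  have key' (k : Fin K) (c d s : n → ℝ) : v ⬝ᵥ d = γ k ⬝ᵥ (B k *ᵥ c) + (ν k ⬝ᵥ (B₀ *ᵥ d) +
      (p k ⬝ᵥ (d - c - s) + (q k ⬝ᵥ (c - d - s) + lam * ∑ a, s a))) := by
    have h := key (Pi.single k c) (Pi.single k d) (Pi.single k s)
    rw [Finset.sum_eq_single k (fun j _ hj => by simp [Pi.single_eq_of_ne hj]) (by simp),
      Finset.sum_eq_single k (fun j _ hj => by simp [Pi.single_eq_of_ne hj]) (by simp),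
      Finset.sum_eq_single k (fun j _ hj => by simp [Pi.single_eq_of_ne hj]) (by simp),
      Finset.sum_eq_single k (fun j _ hj => by simp [Pi.single_eq_of_ne hj]) (by simp),
      Finset.sum_eq_single k (fun j _ hj => by simp [Pi.single_eq_of_ne hj]) (by simp),
      Finset.sum_eq_single k (fun j _ hj => by simp [Pi.single_eq_of_ne hj]) (by simp)] at h
    simp only [Pi.single_eq_same] at h
    exact h
  -- Testing the identity on unit vectors in `c`, `d` and `s` gives the dual equations. With `p, q ≥
  -- 0`, the equation `lam = p + q` turns `p - q` into a vector bounded by `lam`.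
  have hc (k : Fin K) (a : n) : ((B k)ᵀ *ᵥ γ k) a = p k a - q k a := by
    have h := key' k (Pi.single a 1) 0 0
    rw [Matrix.dotProduct_mulVec, ← Matrix.mulVec_transpose] at h
    simp at h
    linarith
  have hd (k : Fin K) (a : n) : v a = (B₀ᵀ *ᵥ ν k) a + p k a - q k a := by
    have h := key' k 0 (Pi.single a 1) 0
    rw [Matrix.dotProduct_mulVec (ν k), ← Matrix.mulVec_transpose] at h
    simp at h
    linarith
  have hs (k : Fin K) (a : n) : lam = p k a + q k a := by
    have h := key' k 0 0 (Pi.single a 1)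
    simp at h
    linarith
  have hp0 (k : Fin K) (a : n) : 0 ≤ p k a := hμ _
  have hq0 (k : Fin K) (a : n) : 0 ≤ q k a := hμ _
  refine ⟨lam, ν, γ, hμ _, fun k i => hμ _, fun k i => hμ _, fun k => ?_, fun k a => ?_, ?_⟩
  · ext a
    rw [Pi.sub_apply, hc, hd k a]
    ring
  · rw [hc, hs k a, abs_le]
    constructor <;> linarith [hp0 k a, hq0 k a]
  · simp only [ι, Fintype.sum_sum_type, Fintype.sum_sigma, Fintype.sum_prod_type,
      Finset.univ_unique, Finset.sum_singleton] at hb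
    simp only [β, Sum.elim_inl, Sum.elim_inr, mul_zero, Finset.sum_const_zero] at hb
    have e1 : ∑ k, b₀ ⬝ᵥ ν k = ∑ k, ∑ i, ν k i * b₀ i :=
      Finset.sum_congr rfl fun k _ => dotProduct_comm _ _
    have e2 : ∑ k, b k ⬝ᵥ γ k = ∑ k, ∑ i, γ k i * b k i :=
      Finset.sum_congr rfl fun k _ => dotProduct_comm _ _
    rw [e1, e2]
    change _ + (_ + (0 + (0 + lam * R))) ≤ M at hb
    linarith

/-! ### Uniform atomic distributions and weak duality over the Wasserstein ball -/

section Empirical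

variable {n : Type} [Fintype n] {K : ℕ}

theorem l1norm_nonneg (c : n → ℝ) : 0 ≤ l1norm c := Finset.sum_nonneg fun _ _ => abs_nonneg _

@[fun_prop]
theorem continuous_l1norm : Continuous (l1norm : (n → ℝ) → ℝ) := by
  unfold l1norm
  fun_prop

theorem dotProduct_le_mul_l1norm {u c : n → ℝ} {lam : ℝ} (hu : ∀ a, |u a| ≤ lam) :
    u ⬝ᵥ c ≤ lam * l1norm c := by
  rw [l1norm, Finset.mul_sum]
  refine Finset.sum_le_sum fun a _ => ?_
  calc u a * c a ≤ |u a| * |c a| := by rw [← abs_mul]; exact le_abs_self _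
    _ ≤ lam * |c a| := mul_le_mul_of_nonneg_right (hu a) (abs_nonneg _)

/-- The uniform distribution on a finite list of points. -/
def uniformAtoms {α : Type*} [MeasurableSpace α] (a : Fin K → α) : Measure α :=
  (K : ℝ≥0∞)⁻¹ • ∑ k, Measure.dirac (a k)

theorem empirical_eq_uniformAtoms {n : Type} (C : Fin K → n → ℝ) : empirical C = uniformAtoms C := rfl

section uniformAtoms

variable {α β : Type*} [MeasurableSpace α] [MeasurableSpace β]

theorem isProbabilityMeasure_uniformAtoms (hK : 0 < K) (a : Fin K → α) :
    IsProbabilityMeasure (uniformAtoms a) := by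
  constructor
  have h0 : (K : ℝ≥0∞) ≠ 0 := by exact_mod_cast hK.ne'
  simp [uniformAtoms, ENNReal.inv_mul_cancel h0 (ENNReal.natCast_ne_top K)]

theorem map_uniformAtoms {f : α → β} (hf : Measurable f) (a : Fin K → α) :
    (uniformAtoms a).map f = uniformAtoms fun k => f (a k) := by
  unfold uniformAtoms
  rw [Measure.map_smul, Measure.map_finset_sum hf.aemeasurable]
  simp only [Measure.map_dirac' hf]

theorem integrable_uniformAtoms [MeasurableSingletonClass α] (hK : 0 < K) (a : Fin K → α)
    (g : α → ℝ) : Integrable g (uniformAtoms a) := by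
  refine Integrable.smul_measure ?_ (by simpa using hK.ne')
  exact integrable_finsetSum_measure.2 fun k _ => integrable_dirac (by simp)

theorem integral_uniformAtoms [MeasurableSingletonClass α] (a : Fin K → α) (g : α → ℝ) :
    ∫ x, g x ∂uniformAtoms a = 1 / (K : ℝ) * ∑ k, g (a k) := by
  rw [uniformAtoms, integral_smul_measure,
    integral_finsetSum_measure fun k _ => integrable_dirac (by simp)]
  simp

theorem uniformAtoms_apply_eq_zero {a : Fin K → α} {s : Set α} (hs : MeasurableSet s)
    (h : ∀ k, a k ∉ s) : uniformAtoms a s = 0 := by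
  simp [uniformAtoms, hs, h]

end uniformAtoms

/-- The uniform distribution on the pairs `(C k, d k)` is a coupling, and its cost is the mean of
the distances. -/
theorem empirical_mem_ambiguitySet (hK : 0 < K) {S₀ : Set (n → ℝ)} (hS₀ : MeasurableSet S₀)
    {ε : ℝ} {C d : Fin K → n → ℝ} (hd : ∀ k, d k ∈ S₀)
    (hR : ∑ k, l1norm (C k - d k) ≤ K * ε) : empirical d ∈ ambiguitySet S₀ ε C := by
  refine ⟨⟨isProbabilityMeasure_uniformAtoms hK d,
    uniformAtoms_apply_eq_zero hS₀.compl fun k => by simpa using hd k⟩, ?_⟩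
  have hprob := isProbabilityMeasure_uniformAtoms hK fun k => (C k, d k)
  refine (iInf₂_le (uniformAtoms fun k => (C k, d k))
    ⟨hprob, map_uniformAtoms measurable_fst _, map_uniformAtoms measurable_snd _⟩).trans ?_
  rw [← ofReal_integral_eq_lintegral_ofReal (integrable_uniformAtoms hK _ _)
    (Filter.Eventually.of_forall fun p => l1norm_nonneg _), integral_uniformAtoms]
  refine ENNReal.ofReal_le_ofReal ?_
  have hK' : (0 : ℝ) < K := by exact_mod_cast hK
  rw [one_div, inv_mul_le_iff₀ hK']
  exact hR

theorem integrable_dotProduct {S₀ : Set (n → ℝ)} (hS₀ : Bornology.IsBounded S₀)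
    {Q : Measure (n → ℝ)} (hQ : Q ∈ distributionsOn S₀) (v : n → ℝ) :
    Integrable (fun c => v ⬝ᵥ c) Q := by
  have := hQ.1
  obtain ⟨r, hr⟩ := hS₀.exists_norm_le
  refine Integrable.of_bound (C := ∑ a, |v a| * r) (by fun_prop) ?_
  have hmem : ∀ᵐ c ∂Q, c ∈ S₀ := hQ.2
  filter_upwards [hmem] with c hc
  refine (norm_sum_le _ _).trans (Finset.sum_le_sum fun a _ => ?_)
  rw [norm_mul, Real.norm_eq_abs]
  exact mul_le_mul_of_nonneg_left ((norm_le_pi_norm c a).trans (hr c hc)) (abs_nonneg _)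

/-- A function which at each point of a finite family is one of the values attached to this
point, and at most all of them. -/
theorem exists_min_selection {α : Type*} (C : Fin K → α) (β : Fin K → ℝ) :
    ∃ f : α → ℝ, (∀ k, f (C k) ≤ β k) ∧ ∀ k, ∃ j, C j = C k ∧ f (C k) = β j := by
  classical
  have h (k : Fin K) : ∃ j, C j = C k ∧ ∀ i, C i = C k → β j ≤ β i := by
    obtain ⟨j, hj, hmin⟩ := (Finset.univ.filter fun i => C i = C k).exists_min_image β
      ⟨k, by simp⟩
    exact ⟨j, by simpa using hj, fun i hi => hmin i (by simpa using hi)⟩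
  refine ⟨fun c => if hc : ∃ k, C k = c then β (h hc.choose).choose else 0, fun k => ?_,
    fun k => ?_⟩
  · have hk : ∃ i, C i = C k := ⟨k, rfl⟩
    simp only [dif_pos hk]
    exact (h hk.choose).choose_spec.2 k hk.choose_spec.symm
  · have hk : ∃ i, C i = C k := ⟨k, rfl⟩
    simp only [dif_pos hk]
    exact ⟨_, (h hk.choose).choose_spec.1.trans hk.choose_spec, rfl⟩

/-- Weak duality: a pointwise bound by the transport cost from the atoms bounds the expectation
over the ambiguity set. -/
theorem integral_le_of_mem_ambiguitySet (hK : 0 < K) {S₀ : Set (n → ℝ)}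
    (hS₀ : Bornology.IsBounded S₀) {ε : ℝ} (hε : 0 < ε) {C : Fin K → n → ℝ}
    {Q : Measure (n → ℝ)} (hQ : Q ∈ ambiguitySet S₀ ε C) {v : n → ℝ} {lam : ℝ} (hlam : 0 ≤ lam)
    {β : Fin K → ℝ} (hβ : ∀ k, ∀ c ∈ S₀, v ⬝ᵥ c ≤ β k + lam * l1norm (C k - c)) :
    ∫ c, v ⬝ᵥ c ∂Q ≤ lam * ε + 1 / (K : ℝ) * ∑ k, β k := by
  obtain ⟨hQS, hW⟩ := hQ
  have hQp := hQS.1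
  -- Atoms `C k` may coincide while their `β k` differ, so `β` need not be a function of the origin.
  -- Taking the least value at each atom gives one.
  obtain ⟨f, hfβ, hf⟩ := exists_min_selection C β
  have hint := integrable_dotProduct hS₀ hQS v
  have hKi : (0 : ℝ) ≤ 1 / (K : ℝ) := by positivity
  -- The infimum over couplings need not be known to be attained; the slack `δ` yields a coupling of
  -- cost below `ε + δ`.
  suffices h : ∀ δ : ℝ, 0 < δ →
      ∫ c, v ⬝ᵥ c ∂Q ≤ lam * (ε + δ) + 1 / (K : ℝ) * ∑ k, β k by
    refine le_of_forall_pos_le_add fun η hη => ?_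
    refine (h (η / (lam + 1)) (by positivity)).trans ?_
    have : lam * (η / (lam + 1)) ≤ η := by
      rw [mul_div_assoc', div_le_iff₀ (by positivity)]
      nlinarith
    linarith
  intro δ hδ
  have hlt : wasserstein (empirical C) Q < ENNReal.ofReal (ε + δ) :=
    hW.trans_lt ((ENNReal.ofReal_lt_ofReal_iff (by positivity)).2 (by linarith))
  obtain ⟨π, hπ, hcost⟩ := by simpa only [wasserstein, iInf_lt_iff, exists_prop] using hlt
  obtain ⟨hπp, hfst, hsnd⟩ := hπ
  have hl1meas : Measurable fun p : (n → ℝ) × (n → ℝ) => l1norm (p.1 - p.2) :=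
    (by fun_prop : Continuous fun p : (n → ℝ) × (n → ℝ) => l1norm (p.1 - p.2)).measurable
  have hl1 : Integrable (fun p : (n → ℝ) × (n → ℝ) => l1norm (p.1 - p.2)) π := by
    refine ⟨hl1meas.aestronglyMeasurable, ?_⟩
    rw [hasFiniteIntegral_iff_ofReal (Filter.Eventually.of_forall fun p => l1norm_nonneg _)]
    exact hcost.trans ENNReal.ofReal_lt_top
  have hl1le : ∫ p, l1norm (p.1 - p.2) ∂π ≤ ε + δ := by
    rw [integral_eq_lintegral_of_nonneg_ae (Filter.Eventually.of_forall fun p => l1norm_nonneg _)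
      hl1meas.aestronglyMeasurable]
    exact ENNReal.toReal_le_of_le_ofReal (by positivity) hcost.le
  have hfint : Integrable f (π.map Prod.fst) := by
    rw [hfst]
    exact integrable_uniformAtoms hK C f
  have hvint : Integrable (fun c => v ⬝ᵥ c) (π.map Prod.snd) := by rwa [hsnd]
  have h1 : ∀ᵐ p ∂π, p.1 ∈ Set.range C := by
    have : ∀ᵐ c ∂π.map Prod.fst, c ∈ Set.range C := by
      rw [hfst]
      exact uniformAtoms_apply_eq_zero (Set.finite_range C).measurableSet.compl fun k => by simp
    exact ae_of_ae_map measurable_fst.aemeasurable this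
  have h2 : ∀ᵐ p ∂π, p.2 ∈ S₀ := by
    have : ∀ᵐ c ∂π.map Prod.snd, c ∈ S₀ := by
      rw [hsnd]
      exact hQS.2
    exact ae_of_ae_map measurable_snd.aemeasurable this
  have hfi : Integrable (fun p : (n → ℝ) × (n → ℝ) => f p.1) π :=
    hfint.comp_measurable measurable_fst
  calc ∫ c, v ⬝ᵥ c ∂Q = ∫ p, v ⬝ᵥ p.2 ∂π := by
        rw [← hsnd, integral_map measurable_snd.aemeasurable hvint.1]
    _ ≤ ∫ p, (f p.1 + lam * l1norm (p.1 - p.2)) ∂π := by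
        refine integral_mono_ae (hvint.comp_measurable measurable_snd)
          (hfi.add (hl1.const_mul lam)) ?_
        filter_upwards [h1, h2] with p hp1 hp2
        obtain ⟨k, hk⟩ := hp1
        obtain ⟨j, hj, hfj⟩ := hf k
        rw [← hk, hfj, ← hj]
        exact hβ j p.2 hp2
    _ = ∫ p, f p.1 ∂π + lam * ∫ p, l1norm (p.1 - p.2) ∂π := by
        rw [integral_add hfi (hl1.const_mul lam), integral_const_mul]
    _ = 1 / (K : ℝ) * ∑ k, f (C k) + lam * ∫ p, l1norm (p.1 - p.2) ∂π := by
        rw [← integral_map (f := f) measurable_fst.aemeasurable hfint.1, hfst,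
          empirical_eq_uniformAtoms, integral_uniformAtoms]
    _ ≤ lam * (ε + δ) + 1 / (K : ℝ) * ∑ k, β k := by
        have e1 := mul_le_mul_of_nonneg_left (Finset.sum_le_sum fun k (_ : k ∈ Finset.univ) =>
          hfβ k) hKi
        have e2 := mul_le_mul_of_nonneg_left hl1le hlam
        linarith

end Empirical

/-! ### Strong duality for polyhedral data uncertainty -/

section Polyhedra

variable {n w₀ : Type} [Fintype n] [Fintype w₀]

theorem isClosed_polyhedron {w : Type} (B : Matrix w n ℝ) (b : w → ℝ) :
    IsClosed (polyhedron B b) :=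
  isClosed_le (by fun_prop) continuous_const

theorem dotProduct_le_of_mem_polyhedron {w : Type} [Fintype w] {B : Matrix w n ℝ} {b : w → ℝ}
    {c : n → ℝ} (hc : c ∈ polyhedron B b) {y : w → ℝ} (hy : ∀ i, 0 ≤ y i) :
    (Bᵀ *ᵥ y) ⬝ᵥ c ≤ b ⬝ᵥ y := by
  rw [Matrix.mulVec_transpose, ← Matrix.dotProduct_mulVec, dotProduct_comm b]
  exact Finset.sum_le_sum fun i _ => mul_le_mul_of_nonneg_left (hc i) (hy i)

variable {K : ℕ} {w : Fin K → Type} [∀ k, Fintype (w k)]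

/-- Split `v ⬝ᵥ c` into a part bounded on the support, a part evaluated at `C k` and bounded there,
and a remainder against `C k - c`, which the `l₁`–`l∞` Hölder inequality bounds by λ times the
transport cost. -/
theorem integral_le_dual (hK : 0 < K) {B₀ : Matrix w₀ n ℝ} {b₀ : w₀ → ℝ}
    {B : ∀ k, Matrix (w k) n ℝ} {b : ∀ k, w k → ℝ} {ε : ℝ} (hε : 0 < ε)
    (hS₀ : Bornology.IsBounded (polyhedron B₀ b₀)) {v : n → ℝ} {lam : ℝ} {ν : Fin K → w₀ → ℝ}
    {γ : ∀ k, w k → ℝ} (hlam : 0 ≤ lam) (hν : ∀ k i, 0 ≤ ν k i) (hγ : ∀ k i, 0 ≤ γ k i)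
    (heq : ∀ k, v - B₀ᵀ *ᵥ ν k = (B k)ᵀ *ᵥ γ k) (habs : ∀ k a, |((B k)ᵀ *ᵥ γ k) a| ≤ lam)
    {C : Fin K → n → ℝ} (hC : ∀ k, C k ∈ polyhedron (B k) (b k)) {Q : Measure (n → ℝ)}
    (hQ : Q ∈ ambiguitySet (polyhedron B₀ b₀) ε C) :
    ∫ c, v ⬝ᵥ c ∂Q ≤ lam * ε + 1 / (K : ℝ) * ∑ k, (b₀ ⬝ᵥ ν k + b k ⬝ᵥ γ k) := by
  refine integral_le_of_mem_ambiguitySet hK hS₀ hε hQ hlam fun k c hc => ?_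
  have hv : v = B₀ᵀ *ᵥ ν k + (B k)ᵀ *ᵥ γ k := by rw [← heq k]; abel
  have h1 := dotProduct_le_of_mem_polyhedron hc (hν k)
  have h2 := dotProduct_le_of_mem_polyhedron (hC k) (hγ k)
  have h3 := dotProduct_le_mul_l1norm (u := -((B k)ᵀ *ᵥ γ k)) (c := C k - c) (lam := lam)
    fun a => by simpa using habs k a
  rw [neg_dotProduct, dotProduct_sub] at h3
  rw [hv, add_dotProduct]
  linarith

/-- Strong duality for the maximization over data sets in polyhedra and over the ambiguity
sets around them. -/
theorem exists_optimal_primal_dual (hK : 0 < K) (B₀ : Matrix w₀ n ℝ) (b₀ : w₀ → ℝ)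
    (B : ∀ k, Matrix (w k) n ℝ) (b : ∀ k, w k → ℝ) {ε : ℝ} (hε : 0 < ε)
    (hS₀ : Bornology.IsBounded (polyhedron B₀ b₀))
    (hS : ∀ k, (polyhedron (B k) (b k)).Nonempty ∧ polyhedron (B k) (b k) ⊆ polyhedron B₀ b₀)
    (v : n → ℝ) :
    ∃ C : Fin K → n → ℝ, (∀ k, C k ∈ polyhedron (B k) (b k)) ∧
      ∃ Q ∈ ambiguitySet (polyhedron B₀ b₀) ε C,
      ∃ (lam : ℝ) (ν : Fin K → w₀ → ℝ) (γ : ∀ k, w k → ℝ), 0 ≤ lam ∧ (∀ k i, 0 ≤ ν k i) ∧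
        (∀ k i, 0 ≤ γ k i) ∧ (∀ k, v - B₀ᵀ *ᵥ ν k = (B k)ᵀ *ᵥ γ k) ∧
        (∀ k a, |((B k)ᵀ *ᵥ γ k) a| ≤ lam) ∧
        ∫ c, v ⬝ᵥ c ∂Q = lam * ε + 1 / (K : ℝ) * ∑ k, (b₀ ⬝ᵥ ν k + b k ⬝ᵥ γ k) := by
  have hK' : (0 : ℝ) < K := by exact_mod_cast hK
  have hcomp (k : Fin K) : IsCompact (polyhedron (B k) (b k)) :=
    Metric.isCompact_of_isClosed_isBounded (isClosed_polyhedron _ _) (hS₀.subset (hS k).2)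
  let P : Set ((Fin K → n → ℝ) × (Fin K → n → ℝ)) :=
    (Set.univ.pi (fun k => polyhedron (B k) (b k)) ×ˢ Set.univ.pi (fun _ => polyhedron B₀ b₀)) ∩
      {p | ∑ k, l1norm (p.1 k - p.2 k) ≤ K * ε}
  have hP : IsCompact P :=
    ((isCompact_univ_pi hcomp).prod (isCompact_univ_pi fun _ =>
      Metric.isCompact_of_isClosed_isBounded (isClosed_polyhedron _ _) hS₀)).inter_right
      (isClosed_le (by fun_prop) continuous_const)
  have hmem (c d : Fin K → n → ℝ) : (c, d) ∈ P ↔ ((∀ k, c k ∈ polyhedron (B k) (b k)) ∧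
      ∀ k, d k ∈ polyhedron B₀ b₀) ∧ ∑ k, l1norm (c k - d k) ≤ K * ε := by
    simp [P]
  choose c₀ hc₀ using fun k => (hS k).1
  -- Leaving all points in place costs nothing and stays in the support, since each uncertainty set
  -- is contained in it.
  have hne : (c₀, c₀) ∈ P := (hmem _ _).2 ⟨⟨hc₀, fun k => (hS k).2 (hc₀ k)⟩, by
    simp only [sub_self, l1norm, Pi.zero_apply, abs_zero, Finset.sum_const_zero]
    positivity⟩
  obtain ⟨p, hp, hmax⟩ := hP.exists_isMaxOn ⟨_, hne⟩
    (f := fun p => ∑ k, v ⬝ᵥ p.2 k) (by fun_prop)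
  rw [isMaxOn_iff] at hmax
  obtain ⟨C, d⟩ := p
  obtain ⟨⟨hC, hd⟩, hR⟩ := (hmem C d).1 hp
  obtain ⟨lam, ν, γ, hlam, hν, hγ, heq, habs, hle⟩ := transport_lp_duality B₀ b₀ B b (K * ε) v
    (∑ k, v ⬝ᵥ d k) ⟨C, d, hC, hd, hR⟩
    (fun c' d' hc' hd' hR' => hmax (c', d') ((hmem c' d').2 ⟨⟨hc', hd'⟩, hR'⟩))
  have hQ := empirical_mem_ambiguitySet hK (isClosed_polyhedron B₀ b₀).measurableSet
    hd hR
  refine ⟨C, hC, empirical d, hQ, lam, ν, γ, hlam, hν, hγ, heq, habs,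
    le_antisymm (integral_le_dual hK hε hS₀ hlam hν hγ heq habs hC hQ) ?_⟩
  rw [empirical_eq_uniformAtoms, integral_uniformAtoms, Finset.sum_add_distrib]
  have := mul_le_mul_of_nonneg_left hle (by positivity : 0 ≤ 1 / (K : ℝ))
  refine le_trans (le_of_eq ?_) this
  field_simp
  ring

/-- The worst-case distribution around a fixed data set exists. -/
theorem exists_worstCase_distribution (hK : 0 < K) (B₀ : Matrix w₀ n ℝ) (b₀ : w₀ → ℝ) {ε : ℝ}
    (hε : 0 < ε) (hS₀ : Bornology.IsBounded (polyhedron B₀ b₀)) {C : Fin K → n → ℝ}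
    (hC : ∀ k, C k ∈ polyhedron B₀ b₀) (v : n → ℝ) :
    ∃ Q ∈ ambiguitySet (polyhedron B₀ b₀) ε C,
      ∀ Q' ∈ ambiguitySet (polyhedron B₀ b₀) ε C, ∫ c, v ⬝ᵥ c ∂Q' ≤ ∫ c, v ⬝ᵥ c ∂Q := by
  classical
  -- A fixed data set is the case of singleton uncertainty sets, each being the polyhedron `c ≤ C
  -- k`, `-c ≤ -C k`.
  let A : Matrix (n ⊕ n) n ℝ := Matrix.fromRows 1 (-1)
  have hA (k : Fin K) : polyhedron A (Sum.elim (C k) (-C k)) = {C k} := by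
    ext c
    simp only [polyhedron, A, Set.mem_ofPred_eq, Set.mem_singleton_iff, Matrix.fromRows_mulVec,
      Matrix.one_mulVec, Matrix.neg_mulVec]
    constructor
    · intro h
      exact le_antisymm (fun a => h (Sum.inl a)) fun a => neg_le_neg_iff.1 (h (Sum.inr a))
    · rintro rfl
      exact le_rfl
  obtain ⟨C', hC', Q, hQ, lam, ν, γ, hlam, hν, hγ, heq, habs, hval⟩ :=
    exists_optimal_primal_dual (w := fun _ => n ⊕ n) hK B₀ b₀ (fun _ => A)
      (fun k => Sum.elim (C k) (-C k)) hε hS₀ (fun k => by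
        rw [hA]
        exact ⟨Set.singleton_nonempty _, Set.singleton_subset_iff.2 (hC k)⟩) v
  obtain rfl : C' = C := funext fun k => by simpa [hA] using hC' k
  refine ⟨Q, hQ, fun Q' hQ' => ?_⟩
  rw [hval]
  exact integral_le_dual hK hε hS₀ hlam hν hγ heq habs hC' hQ'

end Polyhedra

/-! ### Closure properties of affine functions and linear systems -/

section AffineConstraints

variable {V : Type} [Fintype V]

/-- Affine functions on a coordinate space. -/
def IsAffineFun (φ : (V → ℝ) → ℝ) : Prop := ∃ (d : V → ℝ) (d₀ : ℝ), ∀ y, φ y = d ⬝ᵥ y + d₀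

namespace IsAffineFun

theorem const (r : ℝ) : IsAffineFun fun _ : V → ℝ => r := ⟨0, r, fun y => by simp⟩

theorem coord (i : V) : IsAffineFun fun y : V → ℝ => y i := by
  classical
  exact ⟨Pi.single i 1, 0, fun y => by simp⟩

theorem add {φ ψ : (V → ℝ) → ℝ} (hφ : IsAffineFun φ) (hψ : IsAffineFun ψ) :
    IsAffineFun fun y => φ y + ψ y := by
  obtain ⟨d, d₀, h⟩ := hφ
  obtain ⟨e, e₀, h'⟩ := hψ
  exact ⟨d + e, d₀ + e₀, fun y => by simp only [h, h', add_dotProduct]; ring⟩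

theorem const_mul (r : ℝ) {φ : (V → ℝ) → ℝ} (hφ : IsAffineFun φ) :
    IsAffineFun fun y => r * φ y := by
  obtain ⟨d, d₀, h⟩ := hφ
  exact ⟨r • d, r * d₀, fun y => by simp only [h, smul_dotProduct, smul_eq_mul]; ring⟩

theorem mul_const {φ : (V → ℝ) → ℝ} (hφ : IsAffineFun φ) (r : ℝ) :
    IsAffineFun fun y => φ y * r := by
  simpa only [mul_comm] using hφ.const_mul r

theorem neg {φ : (V → ℝ) → ℝ} (hφ : IsAffineFun φ) : IsAffineFun fun y => -φ y := by
  simpa only [neg_one_mul] using hφ.const_mul (-1)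

theorem sub {φ ψ : (V → ℝ) → ℝ} (hφ : IsAffineFun φ) (hψ : IsAffineFun ψ) :
    IsAffineFun fun y => φ y - ψ y := by
  simpa only [sub_eq_add_neg] using hφ.add hψ.neg

theorem sum {ι : Type} (s : Finset ι) {φ : ι → (V → ℝ) → ℝ} (hφ : ∀ i, IsAffineFun (φ i)) :
    IsAffineFun fun y => ∑ i ∈ s, φ i y := by
  classical
  induction s using Finset.induction_on with
  | empty => simpa using const 0
  | insert j s hj ih =>
    simp only [Finset.sum_insert hj]
    exact (hφ j).add ih

theorem const_dotProduct {ι : Type} [Fintype ι] (r : ι → ℝ) {φ : ι → (V → ℝ) → ℝ}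
    (hφ : ∀ i, IsAffineFun (φ i)) : IsAffineFun fun y => r ⬝ᵥ fun i => φ i y :=
  sum _ fun i => (hφ i).const_mul (r i)

theorem mulVec {ι κ : Type} [Fintype ι] (A : Matrix κ ι ℝ) {φ : ι → (V → ℝ) → ℝ}
    (hφ : ∀ i, IsAffineFun (φ i)) (j : κ) : IsAffineFun fun y => (A *ᵥ fun i => φ i y) j :=
  const_dotProduct _ hφ

end IsAffineFun

/-- Conditions equivalent to a finite system of linear inequalities. -/
def IsLinearSystem (p : (V → ℝ) → Prop) : Prop :=
  ∃ (ι : Type) (_ : Fintype ι) (A : Matrix ι V ℝ) (b : ι → ℝ), ∀ y, p y ↔ A *ᵥ y ≤ b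

namespace IsLinearSystem

theorem le {φ ψ : (V → ℝ) → ℝ} (hφ : IsAffineFun φ) (hψ : IsAffineFun ψ) :
    IsLinearSystem fun y => φ y ≤ ψ y := by
  obtain ⟨d, d₀, h⟩ := hφ.sub hψ
  refine ⟨Unit, inferInstance, fun _ => d, fun _ => -d₀, fun y => ?_⟩
  have hy := h y
  constructor
  · intro hle _
    change d ⬝ᵥ y ≤ -d₀
    linarith
  · intro hle
    have : d ⬝ᵥ y ≤ -d₀ := hle ()
    linarith

theorem forall_fintype {κ : Type} [Fintype κ] {p : κ → (V → ℝ) → Prop}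
    (hp : ∀ k, IsLinearSystem (p k)) : IsLinearSystem fun y => ∀ k, p k y := by
  choose ι hι A b h using hp
  refine ⟨Σ k, ι k, inferInstance, fun i => A i.1 i.2, fun i => b i.1 i.2, fun y => ?_⟩
  simp only [h]
  exact ⟨fun H i => H i.1 i.2, fun H k i => H ⟨k, i⟩⟩

theorem and {p q : (V → ℝ) → Prop} (hp : IsLinearSystem p) (hq : IsLinearSystem q) :
    IsLinearSystem fun y => p y ∧ q y := by
  obtain ⟨ι, _, A, b, h⟩ := hp
  obtain ⟨κ, _, B, c, h'⟩ := hq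
  refine ⟨ι ⊕ κ, inferInstance, Matrix.fromRows A B, Sum.elim b c, fun y => ?_⟩
  simp only [h, h']
  rw [Matrix.fromRows_mulVec, Sum.elim_le_elim_iff]

theorem eq {φ ψ : (V → ℝ) → ℝ} (hφ : IsAffineFun φ) (hψ : IsAffineFun ψ) :
    IsLinearSystem fun y => φ y = ψ y := by
  simpa only [le_antisymm_iff] using (le hφ hψ).and (le hψ hφ)

/-- A linear system with integrality conditions and an affine objective form a mixed-integer
linear program. -/
theorem exists_milp {p : (V → ℝ) → Prop} (hp : IsLinearSystem p) {φ : (V → ℝ) → ℝ}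
    (hφ : IsAffineFun φ) (s : Set V) :
    ∃ (r : ℕ) (P : MILP r V), P.int = s ∧
      (∀ y, P.Feasible y ↔ p y ∧ ∀ i ∈ s, ∃ z : ℤ, y i = z) ∧ ∀ y, P.obj y = φ y := by
  obtain ⟨ι, _, A, b, h⟩ := hp
  obtain ⟨d, d₀, hd⟩ := hφ
  let e := Fintype.equivFin ι
  refine ⟨Fintype.card ι, ⟨fun i => A (e.symm i), fun i => b (e.symm i), d, d₀, s⟩, rfl,
    fun y => and_congr ?_ Iff.rfl, fun y => (hd y).symm⟩
  rw [h]
  refine ⟨fun H i => ?_, fun H i => H (e.symm i)⟩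
  have := H (e i)
  simp only [Matrix.mulVec, Equiv.symm_apply_apply] at this
  exact this

end IsLinearSystem

end AffineConstraints

/-! ### The single-level program as a mixed-integer linear program -/

namespace Data

variable {n₁ n₂ m K w₀ : ℕ} {w : Fin K → ℕ} (D : Data n₁ n₂ m K w₀ w)

/-- The linear constraints of the single-level reformulation, without integrality. -/
def MipLinear (x : Ix n₁ n₂ → ℝ) (lam : ℝ) (ν : Fin K → Fin w₀ → ℝ)
    (γ : (k : Fin K) → Fin (w k) → ℝ) : Prop :=
  (∀ k a, 1 / (K : ℝ) * ((D.T *ᵥ x) a + D.t₂ a - (D.B₀ᵀ *ᵥ ν k) a) = ((D.B k)ᵀ *ᵥ γ k) a) ∧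
  (∀ k a, -lam ≤ (D.T *ᵥ x) a + D.t₂ a - (D.B₀ᵀ *ᵥ ν k) a) ∧
  (∀ k a, (D.T *ᵥ x) a + D.t₂ a - (D.B₀ᵀ *ᵥ ν k) a ≤ lam) ∧
  (∀ k i, 0 ≤ ν k i) ∧ (∀ k i, 0 ≤ γ k i) ∧ 0 ≤ lam ∧ (∀ a, 0 ≤ x a) ∧
  ∀ i, (D.G₁ *ᵥ fun i => x (Sum.inl i)) i + (D.G₂ *ᵥ fun j => x (Sum.inr j)) i ≤ D.g i

theorem mipFeasible_iff (x : Ix n₁ n₂ → ℝ) (lam : ℝ) (ν : Fin K → Fin w₀ → ℝ)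
    (γ : (k : Fin K) → Fin (w k) → ℝ) :
    D.MipFeasible x lam ν γ ↔
      D.MipLinear x lam ν γ ∧ ∀ j : Fin n₂, ∃ z : ℤ, x (Sum.inr j) = z := by
  constructor
  · rintro ⟨h1, h2, h3, h4, h5, h6, h7⟩
    exact ⟨⟨fun k => congrFun (h1 k), fun k a => (h2 k a).1, fun k a => (h2 k a).2,
      fun k => (h3 k).1, fun k => (h3 k).2, h4, h5, h7⟩, h6⟩
  · rintro ⟨⟨h1, h2, h2', h3, h3', h4, h5, h7⟩, h6⟩
    exact ⟨fun k => funext (h1 k), fun k a => ⟨h2 k a, h2' k a⟩, fun k => ⟨h3 k, h3' k⟩, h4, h5,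
      h6, h7⟩

theorem exists_milp_reformulation :
    ∃ (r : ℕ) (P : MILP r (Var n₁ n₂ K w₀ w)),
      P.int = Set.range (fun j : Fin n₂ => Sum.inl (Sum.inr j)) ∧
      ∀ x lam ν γ,
        (D.MipFeasible x lam ν γ ↔ P.Feasible (varVector x lam ν γ)) ∧
        D.mipObj x lam ν γ = P.obj (varVector x lam ν γ) := by
  let xOf (y : Var n₁ n₂ K w₀ w → ℝ) : Ix n₁ n₂ → ℝ := fun a => y (Sum.inl a)
  let lamOf (y : Var n₁ n₂ K w₀ w → ℝ) : ℝ := y (Sum.inr (Sum.inl ()))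
  let νOf (y : Var n₁ n₂ K w₀ w → ℝ) : Fin K → Fin w₀ → ℝ :=
    fun k i => y (Sum.inr (Sum.inr (Sum.inl (k, i))))
  let γOf (y : Var n₁ n₂ K w₀ w → ℝ) : (k : Fin K) → Fin (w k) → ℝ :=
    fun k i => y (Sum.inr (Sum.inr (Sum.inr ⟨k, i⟩)))
  have hdiff (k : Fin K) (a : Ix n₁ n₂) : IsAffineFun fun y : Var n₁ n₂ K w₀ w → ℝ =>
      (D.T *ᵥ xOf y) a + D.t₂ a - (D.B₀ᵀ *ᵥ νOf y k) a :=
    ((IsAffineFun.mulVec _ (fun _ => .coord _) a).add (.const _)).sub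
      (IsAffineFun.mulVec _ (fun _ => .coord _) a)
  have hlin : IsLinearSystem fun y : Var n₁ n₂ K w₀ w → ℝ =>
      D.MipLinear (xOf y) (lamOf y) (νOf y) (γOf y) := by
    refine .and ?_ (.and ?_ (.and ?_ (.and ?_ (.and ?_ (.and ?_ (.and ?_ ?_))))))
    · exact .forall_fintype fun k => .forall_fintype fun a =>
        .eq ((hdiff k a).const_mul _) (IsAffineFun.mulVec _ (fun _ => .coord _) a)
    · exact .forall_fintype fun k => .forall_fintype fun a => .le (IsAffineFun.coord _).neg (hdiff k a)
    · exact .forall_fintype fun k => .forall_fintype fun a => .le (hdiff k a) (.coord _)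
    · exact .forall_fintype fun k => .forall_fintype fun i => .le (.const _) (.coord _)
    · exact .forall_fintype fun k => .forall_fintype fun i => .le (.const _) (.coord _)
    · exact .le (.const _) (.coord _)
    · exact .forall_fintype fun a => .le (.const _) (.coord _)
    · exact .forall_fintype fun i => .le ((IsAffineFun.mulVec _ (fun _ => .coord _) i).add
        (IsAffineFun.mulVec _ (fun _ => .coord _) i)) (.const _)
  have hobj : IsAffineFun fun y : Var n₁ n₂ K w₀ w → ℝ =>
      D.mipObj (xOf y) (lamOf y) (νOf y) (γOf y) :=
    (((((IsAffineFun.coord _).mul_const _).add (.const_mul _ (.sum _ fun k =>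
      .const_dotProduct _ fun _ => .coord _))).add (.sum _ fun k =>
      .const_dotProduct _ fun _ => .coord _)).add
      (.const_dotProduct _ fun _ => .coord _)).add (.const _)
  obtain ⟨r, P, hint, hfeas, hP⟩ := hlin.exists_milp hobj
    (Set.range fun j : Fin n₂ => Sum.inl (Sum.inr j))
  refine ⟨r, P, hint, fun x lam ν γ => ⟨?_, (hP (varVector x lam ν γ)).symm⟩⟩
  rw [hfeas, mipFeasible_iff, Set.forall_mem_range]
  -- Extracting the blocks of `varVector x lam ν γ` returns `x`, `lam`, `ν`, `γ` definitionally.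
  exact Iff.rfl

variable {D}

/-- Boundedness of the support makes the linear part integrable, so the expectation of the affine
loss splits. -/
theorem expectedLoss_eq (hS₀ : Bornology.IsBounded D.S₀) {C : Fin K → Ix n₁ n₂ → ℝ}
    {Q : Measure (Ix n₁ n₂ → ℝ)} (hQ : Q ∈ ambiguitySet D.S₀ D.ε C) (x : Ix n₁ n₂ → ℝ) :
    D.expectedLoss x Q = ∫ c, (D.T *ᵥ x + D.t₂) ⬝ᵥ c ∂Q + (D.t₁ ⬝ᵥ x + D.t₀) := by
  have := hQ.1.1
  have h (c : Ix n₁ n₂ → ℝ) :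
      D.loss x c = (D.T *ᵥ x + D.t₂) ⬝ᵥ c + (D.t₁ ⬝ᵥ x + D.t₀) := by
    rw [loss, add_dotProduct, dotProduct_comm c]
    ring
  simp only [expectedLoss, h]
  rw [integral_add (integrable_dotProduct hS₀ hQ.1 _) (integrable_const _)]
  simp

end Data

/-! ### Equality of the worst-case loss and the partial minimum of (F^mip) -/

namespace Data

variable {n₁ n₂ m K w₀ : ℕ} {w : Fin K → ℕ} {D : Data n₁ n₂ m K w₀ w}

/-- Multiplying γ by K removes the factor `1 / K` from the equality constraint, which then turns the
box constraint into the bound on `(B k)ᵀ γ k` used in the duality results. -/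
theorem mipFeasible_iff_rescaled (hK : 0 < K) (x : Ix n₁ n₂ → ℝ) (lam : ℝ)
    (ν : Fin K → Fin w₀ → ℝ) (γ : (k : Fin K) → Fin (w k) → ℝ) :
    D.MipFeasible x lam ν γ ↔
      (0 ≤ lam ∧ (∀ k i, 0 ≤ ν k i) ∧ (∀ k i, 0 ≤ ((K : ℝ) • γ k) i) ∧
        (∀ k, D.T *ᵥ x + D.t₂ - D.B₀ᵀ *ᵥ ν k = (D.B k)ᵀ *ᵥ ((K : ℝ) • γ k)) ∧
        ∀ k a, |((D.B k)ᵀ *ᵥ ((K : ℝ) • γ k)) a| ≤ lam) ∧ x ∈ D.X := by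
  have hK' : (0 : ℝ) < K := by exact_mod_cast hK
  have hscale (k : Fin K) :
      (1 / (K : ℝ)) • (D.T *ᵥ x + D.t₂ - D.B₀ᵀ *ᵥ ν k) = (D.B k)ᵀ *ᵥ γ k ↔
        D.T *ᵥ x + D.t₂ - D.B₀ᵀ *ᵥ ν k = (D.B k)ᵀ *ᵥ ((K : ℝ) • γ k) := by
    rw [Matrix.mulVec_smul, one_div, inv_smul_eq_iff₀ hK'.ne']
  constructor
  · rintro ⟨h1, h2, h3, h4, h5⟩
    have heq (k : Fin K) := (hscale k).1 (h1 k)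
    refine ⟨⟨h4, fun k => (h3 k).1, fun k i => mul_nonneg hK'.le ((h3 k).2 i), heq,
      fun k a => ?_⟩, h5⟩
    rw [← heq, abs_le]
    exact h2 k a
  · rintro ⟨⟨h4, hν, hγ, heq, habs⟩, h5⟩
    refine ⟨fun k => (hscale k).2 (heq k), fun k a => ?_,
      fun k => ⟨hν k, fun i => nonneg_of_mul_nonneg_right (hγ k i) hK'⟩, h4, h5⟩
    rw [heq, ← abs_le]
    exact habs k a

theorem mipObj_eq_rescaled (hK : 0 < K) (x : Ix n₁ n₂ → ℝ) (lam : ℝ) (ν : Fin K → Fin w₀ → ℝ)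
    (γ : (k : Fin K) → Fin (w k) → ℝ) :
    D.mipObj x lam ν γ = lam * D.ε +
      1 / (K : ℝ) * ∑ k, (D.b₀ ⬝ᵥ ν k + D.b k ⬝ᵥ ((K : ℝ) • γ k)) + (D.t₁ ⬝ᵥ x + D.t₀) := by
  have hK' : (0 : ℝ) < K := by exact_mod_cast hK
  simp only [mipObj, dotProduct_smul, smul_eq_mul, Finset.sum_add_distrib, ← Finset.mul_sum]
  field_simp
  ring

theorem robustLoss_le_mipObj (hK : 0 < K) (hε : 0 < D.ε) (hS₀ : Bornology.IsBounded D.S₀)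
    {x : Ix n₁ n₂ → ℝ} {lam : ℝ} {ν : Fin K → Fin w₀ → ℝ} {γ : (k : Fin K) → Fin (w k) → ℝ}
    (h : D.MipFeasible x lam ν γ) : D.robustLoss x ≤ (D.mipObj x lam ν γ : EReal) := by
  obtain ⟨⟨hlam, hν, hγ, heq, habs⟩, -⟩ := (mipFeasible_iff_rescaled hK x lam ν γ).1 h
  refine iSup₂_le fun C hC => iSup₂_le fun Q hQ => EReal.coe_le_coe_iff.2 ?_
  rw [expectedLoss_eq hS₀ hQ, mipObj_eq_rescaled hK]
  exact add_le_add_left (integral_le_dual (w := fun k => Fin (w k)) hK hε hS₀ hlam hν hγ heq habs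
    hC hQ) _

theorem exists_worstCase_eq (hK : 0 < K) (hε : 0 < D.ε) (hS₀ : Bornology.IsBounded D.S₀)
    (hS : ∀ k, (D.S k).Nonempty ∧ D.S k ⊆ D.S₀) (x : Ix n₁ n₂ → ℝ)
    {C : Fin K → Ix n₁ n₂ → ℝ} (hC : C ∈ D.dataSets) :
    ∃ Q ∈ ambiguitySet D.S₀ D.ε C, (D.expectedLoss x Q : EReal) = D.worstCase x C := by
  obtain ⟨Q, hQ, hmax⟩ := exists_worstCase_distribution hK D.B₀ D.b₀ hε hS₀
    (fun k => (hS k).2 (hC k)) (D.T *ᵥ x + D.t₂)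
  refine ⟨Q, hQ, le_antisymm (le_iSup₂_of_le Q hQ le_rfl) (iSup₂_le fun Q' hQ' => ?_)⟩
  rw [EReal.coe_le_coe_iff, expectedLoss_eq hS₀ hQ, expectedLoss_eq hS₀ hQ']
  exact add_le_add_left (hmax Q' hQ') _

/-- A data set, a distribution and dual variables with equal objective values. -/
theorem exists_expectedLoss_eq_mipObj (hK : 0 < K) (hε : 0 < D.ε)
    (hS₀ : Bornology.IsBounded D.S₀) (hS : ∀ k, (D.S k).Nonempty ∧ D.S k ⊆ D.S₀)
    {x : Ix n₁ n₂ → ℝ} (hx : x ∈ D.X) :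
    ∃ C ∈ D.dataSets, ∃ Q ∈ ambiguitySet D.S₀ D.ε C, ∃ lam ν γ, D.MipFeasible x lam ν γ ∧
      D.expectedLoss x Q = D.mipObj x lam ν γ := by
  have hK' : (K : ℝ) ≠ 0 := by exact_mod_cast hK.ne'
  obtain ⟨C, hC, Q, hQ, lam, ν, γ, hlam, hν, hγ, heq, habs, hval⟩ :=
    exists_optimal_primal_dual (w := fun k => Fin (w k)) hK D.B₀ D.b₀ D.B D.b hε hS₀ hS
      (D.T *ᵥ x + D.t₂)
  have hsc (k : Fin K) : (K : ℝ) • ((K : ℝ)⁻¹ • γ k) = γ k := smul_inv_smul₀ hK' _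
  refine ⟨C, hC, Q, hQ, lam, ν, fun k => (K : ℝ)⁻¹ • γ k, ?_, ?_⟩
  · rw [mipFeasible_iff_rescaled hK]
    simp only [hsc]
    exact ⟨⟨hlam, hν, hγ, heq, habs⟩, hx⟩
  · rw [mipObj_eq_rescaled hK, expectedLoss_eq hS₀ hQ, hval]
    simp only [hsc]

/-- The chain `mipObj = expectedLoss ≤ worstCase ≤ robustLoss ≤ mipObj` collapses to equalities. -/
theorem robustLoss_attained (hK : 0 < K) (hε : 0 < D.ε) (hS₀ : Bornology.IsBounded D.S₀)
    (hS : ∀ k, (D.S k).Nonempty ∧ D.S k ⊆ D.S₀) {x : Ix n₁ n₂ → ℝ} (hx : x ∈ D.X) :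
    (∃ C ∈ D.dataSets, D.worstCase x C = D.robustLoss x) ∧
      ∃ lam ν γ, D.MipFeasible x lam ν γ ∧ (D.mipObj x lam ν γ : EReal) = D.robustLoss x := by
  obtain ⟨C, hC, Q, hQ, lam, ν, γ, hfeas, heq⟩ := exists_expectedLoss_eq_mipObj hK hε hS₀ hS hx
  have h1 : (D.mipObj x lam ν γ : EReal) ≤ D.worstCase x C := by
    rw [← heq]
    exact le_iSup₂_of_le Q hQ le_rfl
  have h2 : D.worstCase x C ≤ D.robustLoss x := le_iSup₂_of_le C hC le_rfl
  have h3 := robustLoss_le_mipObj hK hε hS₀ hfeas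
  exact ⟨⟨C, hC, le_antisymm h2 (h3.trans h1)⟩, lam, ν, γ, hfeas, le_antisymm (h1.trans h2) h3⟩

theorem mipFeasible_mem_X {x : Ix n₁ n₂ → ℝ} {lam : ℝ} {ν : Fin K → Fin w₀ → ℝ}
    {γ : (k : Fin K) → Fin (w k) → ℝ} (h : D.MipFeasible x lam ν γ) : x ∈ D.X := h.2.2.2.2

end Data

end DRO

end

theorem theorem1 {n₁ n₂ m K w₀ : ℕ} {w : Fin K → ℕ} (D : DRO.Data n₁ n₂ m K w₀ w)
    (hK : 0 < K) (hε : 0 < D.ε) (hT : D.T.IsSymm)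
    (hS₀ : Bornology.IsBounded D.S₀)
    (hS : ∀ k, (D.S k).Nonempty ∧ D.S k ⊆ D.S₀) :
    -- (F^mip) is a mixed-integer linear program whose integer variables are those of `x⁽²⁾`
    (∃ (r : ℕ) (P : DRO.MILP r (DRO.Var n₁ n₂ K w₀ w)),
      P.int = Set.range (fun j : Fin n₂ => Sum.inl (Sum.inr j)) ∧
      ∀ x lam ν γ,
        (D.MipFeasible x lam ν γ ↔ P.Feasible (DRO.varVector x lam ν γ)) ∧
        D.mipObj x lam ν γ = P.obj (DRO.varVector x lam ν γ)) ∧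
    -- for every decision, both maxima in (F) are attained, and the worst-case loss is the
    -- (attained) minimum of (F^mip) over the remaining variables
    (∀ x ∈ D.X,
      (∀ C ∈ D.dataSets, ∃ Q ∈ DRO.ambiguitySet D.S₀ D.ε C,
        (D.expectedLoss x Q : EReal) = D.worstCase x C) ∧
      (∃ C ∈ D.dataSets, D.worstCase x C = D.robustLoss x) ∧
      (∃ lam ν γ, D.MipFeasible x lam ν γ ∧ (D.mipObj x lam ν γ : EReal) = D.robustLoss x) ∧
      (∀ lam ν γ, D.MipFeasible x lam ν γ → D.robustLoss x ≤ (D.mipObj x lam ν γ : EReal))) ∧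
    -- the optimal values coincide
    D.valueF = D.valueMip ∧
    -- the optimal decisions coincide
    (∀ x, D.IsOptimalF x ↔ ∃ lam ν γ, D.IsOptimalMip x lam ν γ) := by
  -- These two facts say that `robustLoss x` is the attained minimum over the dual variables; equal
  -- values and equal optimal decisions then follow from minimizing in two stages.
  have hle {x lam ν γ} (h : D.MipFeasible x lam ν γ) :=
    DRO.Data.robustLoss_le_mipObj hK hε hS₀ h
  have hatt {x} (hx : x ∈ D.X) := DRO.Data.robustLoss_attained hK hε hS₀ hS hx
  refine ⟨D.exists_milp_reformulation, fun x hx => ⟨fun C hC =>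
    DRO.Data.exists_worstCase_eq hK hε hS₀ hS x hC, (hatt hx).1, (hatt hx).2,
    fun lam ν γ h => hle h⟩, le_antisymm ?_ ?_, fun x => ⟨?_, ?_⟩⟩
  · exact le_iInf fun x => le_iInf fun lam => le_iInf fun ν => le_iInf fun γ => le_iInf fun h =>
      (iInf₂_le x (DRO.Data.mipFeasible_mem_X h)).trans (hle h)
  · refine le_iInf₂ fun x hx => ?_
    obtain ⟨lam, ν, γ, h, heq⟩ := (hatt hx).2
    rw [← heq]
    exact iInf_le_of_le x (iInf_le_of_le lam (iInf_le_of_le ν (iInf_le_of_le γ (iInf_le _ h))))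
  · rintro ⟨hx, hmin⟩
    obtain ⟨lam, ν, γ, h, heq⟩ := (hatt hx).2
    refine ⟨lam, ν, γ, h, fun x' lam' ν' γ' h' => EReal.coe_le_coe_iff.1 ?_⟩
    rw [heq]
    exact (hmin x' (DRO.Data.mipFeasible_mem_X h')).trans (hle h')
  · rintro ⟨lam, ν, γ, h, hmin⟩
    refine ⟨DRO.Data.mipFeasible_mem_X h, fun x' hx' => ?_⟩
    obtain ⟨lam', ν', γ', h', heq⟩ := (hatt hx').2
    rw [← heq]
    exact (hle h).trans (EReal.coe_le_coe_iff.2 (hmin _ _ _ _ h'))
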